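/- Let $p$ be an odd prime, let $\alpha,\beta\ge 0$ be integers with $\gcd(\beta,p)=1$, and identify $\mathbb{Z}_p^{\alpha}\times\mathbb{Z}_{p^2}^{\beta}$ with $\mathbb{Z}_p[x]/(x^\alpha-1)\times\mathbb{Z}_{p^2}[x]/(x^\beta-1)$ via $(u_0,\dots,u_{\alpha-1},v_0,\dots,v_{\beta-1})\mapsto\bigl(\sum_i u_ix^i,\sum_i v_ix^i\bigr)$ (for $\alpha=0$ the first factor is zero). For $d\in\mathbb{Z}_{p^2}[x]$ let $\overline d\in\mathbb{Z}_p[x]$ be its reduction modulo $p$ and put $d\star(c_1,c_2)=(\overline d\,c_1,d\,c_2)$; let $\langle S\rangle$ denote the $\mathbb{Z}_{p^2}[x]$-submodule generated by $S$ with respect to $\star$. A $\mathbb{Z}_p\mathbb{Z}_{p^2}$-additive cyclic code is a subgroup of $\mathbb{Z}_p^{\alpha}\times\mathbb{Z}_{p^2}^{\beta}$ that is closed under the simultaneous cyclic shift of the two blocks of coordinates. Let $f,h,g\in\mathbb{Z}_{p^2}[x]$ have invertible leading coefficients (for instance, be monic) and satisfy $fhg=x^\beta-1$. Let $a,b\in\mathbb{Z}_p[x]$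 satisfy $a\mid x^\alpha-1$, $\deg a\le\alpha$ (automatic if $\alpha\ge1$; here $\deg 0=0$) and $a\mid \overline{h}\,\overline{g}\,b$. Let $$\mathcal{C}=\langle (a,0),\,(b,fh+pf)\rangle$$ be the corresponding $\mathbb{Z}_p\mathbb{Z}_{p^2}$-additive cyclic code. Let $\kappa$ be the dimension over $\mathbb{Z}_p$ of the projection of $\mathcal{C}_p=\{c\in\mathcal{C}:pc=0\}$ to the first $\alpha$ coordinates, let $\kappa_1$ be the dimension over $\mathbb{Z}_p$ of the subcode $\{(u,0)\in\mathcal{C}\}$, and let $\kappa_2=\kappa-\kappa_1$. Then: (1) for integers $\gamma,\delta\ge 0$, the group $\mathcal{C}$ is isomorphic to $\mathbb{Z}_p^{\gamma}\times\mathbb{Z}_{p^2}^{\delta}$ if and only if $\gamma=\alpha-\deg a+\deg h$ and $\delta=\deg g$; (2) $\kappa=\alpha-\deg\gcd(a,b\overline g)$, $\kappa_1=\alpha-\deg a$ and $\kappa_2=\deg a-\deg\gcd(a,b\overline g)$. -/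

import Mathlib

open Polynomial

noncomputable section

namespace ZpZp2

/-- The ambient group `ℤ_p^α × ℤ_{p²}^β`. -/
abbrev Word (p α β : ℕ) : Type := (Fin α → ZMod p) × (Fin β → ZMod (p ^ 2))

/-- Cyclic shift of a vector: `(v_0, …, v_{n-1}) ↦ (v_{n-1}, v_0, …, v_{n-2})`. -/
def shiftVec {R : Type*} {n : ℕ} (v : Fin n → R) : Fin n → R :=
  fun i => v ((finRotate n).symm i)

/-- Simultaneous cyclic shift of the two blocks of a word. -/
def shift {p α β : ℕ} (w : Word p α β) : Word p α β :=
  (shiftVec w.1, shiftVec w.2)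

/-- An additive code (a subgroup of `ℤ_p^α × ℤ_{p²}^β`) is cyclic if it is closed under the
simultaneous cyclic shift of the two blocks. -/
def IsCyclicCode {p α β : ℕ} (C : AddSubgroup (Word p α β)) : Prop :=
  ∀ w ∈ C, shift w ∈ C

/-- The polynomial `v_0 + v_1 x + ⋯ + v_{n-1} x^{n-1}` of a vector. -/
def ofVec {R : Type*} [CommRing R] {n : ℕ} (v : Fin n → R) : R[X] :=
  ∑ i : Fin n, C (v i) * X ^ (i : ℕ)

/-- The vector of a polynomial regarded as an element of `R[x]/(x^n - 1)`: the coefficients of its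
remainder modulo `x^n - 1`. (For `n = 0` this is the unique empty vector.) -/
def toVec {R : Type*} [CommRing R] (n : ℕ) (q : R[X]) : Fin n → R :=
  fun i => (q %ₘ (X ^ n - 1)).coeff i

/-- The word of a pair of polynomials, under the identification of `ℤ_p^α × ℤ_{p²}^β` with
`ℤ_p[x]/(x^α - 1) × ℤ_{p²}[x]/(x^β - 1)`. -/
def toWord {p : ℕ} (α β : ℕ) (q : (ZMod p)[X]) (r : (ZMod (p ^ 2))[X]) : Word p α β :=
  (toVec α q, toVec β r)

/-- Reduction modulo `p` of a polynomial over `ℤ_{p²}`. -/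
def reduce {p : ℕ} (q : (ZMod (p ^ 2))[X]) : (ZMod p)[X] :=
  q.map (ZMod.castHom (dvd_pow_self p two_ne_zero) (ZMod p))

/-- The multiplication `d ⋆ (c₁, c₂) = (d̄ c₁, d c₂)` of a word by a polynomial over `ℤ_{p²}`. -/
def star {p α β : ℕ} (d : (ZMod (p ^ 2))[X]) (w : Word p α β) : Word p α β :=
  toWord α β (reduce d * ofVec w.1) (d * ofVec w.2)

/-- The `ℤ_{p²}[x]`-submodule `⟨S⟩` generated by a set of words: all finite sums of elements
`± d ⋆ s` with `s ∈ S`. -/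
def polySpan {p α β : ℕ} (S : Set (Word p α β)) : AddSubgroup (Word p α β) :=
  AddSubgroup.closure {w | ∃ d : (ZMod (p ^ 2))[X], ∃ s ∈ S, w = star d s}

/-- `C` is isomorphic, as an abelian group, to `ℤ_p^γ × ℤ_{p²}^δ`. -/
def HasGroupType {p α β : ℕ} (C : AddSubgroup (Word p α β)) (γ δ : ℕ) : Prop :=
  Nonempty (C ≃+ (Fin γ → ZMod p) × (Fin δ → ZMod (p ^ 2)))

/-- The subcode `C_p = {c ∈ C : p c = 0}`. -/
def torsionSubcode {p α β : ℕ} (C : AddSubgroup (Word p α β)) : AddSubgroup (Word p α β) :=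
  C ⊓ (nsmulAddMonoidHom p : Word p α β →+ Word p α β).ker

/-- The punctured code `C_X`: the projection of `C` to the first block, a linear code over
`ℤ_p`. -/
def punctureX {p α β : ℕ} (C : AddSubgroup (Word p α β)) :
    Submodule (ZMod p) (Fin α → ZMod p) :=
  AddSubgroup.toZModSubmodule p
    (C.map (AddMonoidHom.fst (Fin α → ZMod p) (Fin β → ZMod (p ^ 2))))

/-- The vectors `u` with `(u, 0) ∈ C`, a linear code over `ℤ_p`. -/
def kernelX {p α β : ℕ} (C : AddSubgroup (Word p α β)) :
    Submodule (ZMod p) (Fin α → ZMod p) :=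
  AddSubgroup.toZModSubmodule p
    (C.comap (AddMonoidHom.inl (Fin α → ZMod p) (Fin β → ZMod (p ^ 2))))

/-- `κ`, the dimension of `(C_p)_X` over `ℤ_p`. -/
def kappa {p α β : ℕ} (C : AddSubgroup (Word p α β)) : ℕ :=
  Module.finrank (ZMod p) (punctureX (torsionSubcode C))

/-- `κ₁`, the dimension over `ℤ_p` of the subcode of the words `(u, 0) ∈ C`. -/
def kappa₁ {p α β : ℕ} (C : AddSubgroup (Word p α β)) : ℕ :=
  Module.finrank (ZMod p) (kernelX C)

/-- `κ₂ = κ - κ₁`. -/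
def kappa₂ {p α β : ℕ} (C : AddSubgroup (Word p α β)) : ℤ :=
  (kappa C : ℤ) - (kappa₁ C : ℤ)

end ZpZp2

end

/-! A finite group of exponent dividing p² is determined by the orders of its p-torsion and of its
multiples of p, so everything reduces to counting in 𝒞 = {(qa + d̄b, d(fh + pf))}. The facts used
are p² = 0, px = 0 ⇔ x̄ = 0, and cancellation of factors with unit leading coefficient. Since p·d(fh
+ pf) = fh·(pd), a word is p-torsion iff ḡ ∣ d̄. Hence p𝒞 has p^(deg g) elements, and the first
blocks of 𝒞_p are the multiples of gcd(a, bḡ), which gives κ. If the second block vanishes then h̄ḡ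
∣ d̄ (`reduceHom_dvd_of_toVec_eq_zero`; here h̄ and ḡ are coprime because p ∤ β), so a ∣ d̄b and the
words (u, 0) are the multiples of a, which gives κ₁. Finally, 𝒞_p projects onto the multiples of pf
with kernel {(u, 0)}, so |𝒞_p| = p^(κ₁ + deg h + deg g). -/

noncomputable section

namespace ZpZp2

/-! ### Vectors as residues modulo x^n - 1 -/

section Vectors

variable {R : Type*} [CommRing R]

/-- `toVec` as an additive homomorphism. -/
def toVecHom (n : ℕ) : R[X] →+ (Fin n → R) where
  toFun := toVec n
  map_zero' := by ext; simp [toVec]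
  map_add' q r := by ext; simp [toVec, add_modByMonic]

theorem toVec_eq_zero_of_dvd {n : ℕ} {q : R[X]} (h : X ^ n - 1 ∣ q) : toVec n q = 0 := by
  -- For n = 0 the modulus is 0, which is not monic, but all vectors are empty.
  rcases Nat.eq_zero_or_pos n with rfl | hn
  · exact Subsingleton.elim _ _
  · have hm : (X ^ n - 1 : R[X]).Monic := monic_X_pow_sub_C 1 hn.ne'
    ext i
    simp [toVec, (modByMonic_eq_zero_iff_dvd hm).2 h]

theorem ofVec_toVec {n : ℕ} (hn : 0 < n) (q : R[X]) :
    ofVec (toVec n q) = q %ₘ (X ^ n - 1) := by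
  nontriviality R
  have hm : (X ^ n - 1 : R[X]).Monic := monic_X_pow_sub_C 1 hn.ne'
  have hd : (X ^ n - 1 : R[X]).natDegree = n := natDegree_X_pow_sub_C (r := 1)
  have hlt : (q %ₘ (X ^ n - 1)).natDegree < n := by
    have h1 : (X ^ n - 1 : R[X]) ≠ 1 := fun h => by
      rw [h, natDegree_one] at hd
      omega
    simpa only [hd] using natDegree_modByMonic_lt q hm h1
  conv_rhs => rw [as_sum_range_C_mul_X_pow' _ hlt]
  exact Fin.sum_univ_eq_sum_range (fun i => C ((q %ₘ (X ^ n - 1)).coeff i) * X ^ i) n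

theorem toVec_eq_zero_iff {n : ℕ} (hn : 0 < n) {q : R[X]} :
    toVec n q = 0 ↔ X ^ n - 1 ∣ q := by
  refine ⟨fun h => ?_, toVec_eq_zero_of_dvd⟩
  have hm : (X ^ n - 1 : R[X]).Monic := monic_X_pow_sub_C 1 hn.ne'
  rw [← modByMonic_eq_zero_iff_dvd hm, ← ofVec_toVec hn, h]
  simp [ofVec]

theorem toVec_eq_of_dvd_sub {n : ℕ} {q r : R[X]} (h : X ^ n - 1 ∣ q - r) :
    toVec n q = toVec n r := by
  have := toVec_eq_zero_of_dvd h
  exact sub_eq_zero.1 (((toVecHom n).map_sub q r).symm.trans this)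

theorem toVec_mul_ofVec_toVec {n : ℕ} (d q : R[X]) :
    toVec n (d * ofVec (toVec n q)) = toVec n (d * q) := by
  rcases Nat.eq_zero_or_pos n with rfl | hn
  · exact Subsingleton.elim _ _
  · apply toVec_eq_of_dvd_sub
    rw [ofVec_toVec hn, ← mul_sub]
    refine Dvd.dvd.mul_left ⟨-(q /ₘ (X ^ n - 1)), ?_⟩ d
    linear_combination modByMonic_add_div q (X ^ n - 1)

end Vectors

/-! ### Reduction modulo p and orders of cyclic images -/

section Reduction

variable {p : ℕ}

/-- `reduce` as a ring homomorphism. -/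
def reduceHom (p : ℕ) : (ZMod (p ^ 2))[X] →+* (ZMod p)[X] :=
  mapRingHom (ZMod.castHom (dvd_pow_self p two_ne_zero) (ZMod p))

theorem reduceHom_surjective : Function.Surjective (reduceHom p) :=
  map_surjective _ (ZMod.ringHom_surjective _)

theorem natCast_sq_eq_zero : (p : (ZMod (p ^ 2))[X]) * p = 0 := by
  have : ((p ^ 2 : ℕ) : (ZMod (p ^ 2))[X]) = 0 := CharP.cast_eq_zero _ _
  rw [← this]; push_cast; ring

variable [Fact p.Prime]

instance : Nontrivial (ZMod (p ^ 2)) :=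
  ZMod.nontrivial_iff.2 (by
    have := (Fact.out : p.Prime).one_lt
    exact (Nat.one_lt_pow two_ne_zero this).ne')

instance : NeZero (p ^ 2) := ⟨pow_ne_zero 2 (Fact.out : p.Prime).ne_zero⟩

theorem natCast_mul_eq_zero_iff (x : ZMod (p ^ 2)) :
    (p : ZMod (p ^ 2)) * x = 0 ↔ ZMod.castHom (dvd_pow_self p two_ne_zero) (ZMod p) x = 0 := by
  obtain ⟨n, rfl⟩ := ZMod.natCast_zmod_surjective x
  rw [map_natCast, ZMod.natCast_eq_zero_iff, ← Nat.cast_mul, ZMod.natCast_eq_zero_iff, sq]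
  exact Nat.mul_dvd_mul_iff_left (Fact.out : p.Prime).pos

theorem castHom_eq_zero_iff_dvd (x : ZMod (p ^ 2)) :
    ZMod.castHom (dvd_pow_self p two_ne_zero) (ZMod p) x = 0 ↔ (p : ZMod (p ^ 2)) ∣ x := by
  constructor
  · obtain ⟨n, rfl⟩ := ZMod.natCast_zmod_surjective x
    rw [map_natCast, ZMod.natCast_eq_zero_iff]
    exact fun h => Nat.cast_dvd_cast h
  · rintro ⟨y, rfl⟩
    simp

theorem natCast_mul_poly_eq_zero_iff (q : (ZMod (p ^ 2))[X]) :
    (p : (ZMod (p ^ 2))[X]) * q = 0 ↔ reduceHom p q = 0 := by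
  have : (p : (ZMod (p ^ 2))[X]) = C (p : ZMod (p ^ 2)) := by simp
  simp only [this, Polynomial.ext_iff, coeff_C_mul, coeff_zero, natCast_mul_eq_zero_iff]
  simp [reduceHom]

theorem reduceHom_eq_zero_iff_dvd (q : (ZMod (p ^ 2))[X]) :
    reduceHom p q = 0 ↔ (p : (ZMod (p ^ 2))[X]) ∣ q := by
  have : (p : (ZMod (p ^ 2))[X]) = C (p : ZMod (p ^ 2)) := by simp
  simp only [this, C_dvd_iff_dvd_coeff, ← castHom_eq_zero_iff_dvd]
  simp [reduceHom, Polynomial.ext_iff]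

theorem natDegree_reduceHom {q : (ZMod (p ^ 2))[X]} (h : IsUnit q.leadingCoeff) :
    (reduceHom p q).natDegree = q.natDegree :=
  natDegree_map_eq_of_isUnit_leadingCoeff _ h

theorem reduceHom_ne_zero {q : (ZMod (p ^ 2))[X]} (h : IsUnit q.leadingCoeff) :
    reduceHom p q ≠ 0 := by
  rw [Ne, ← leadingCoeff_eq_zero]
  have := leadingCoeff_map_eq_of_isUnit_leadingCoeff
    (ZMod.castHom (dvd_pow_self p two_ne_zero) (ZMod p)) h
  exact this ▸ (h.map _).ne_zero

theorem isUnit_leadingCoeff_mul {R : Type*} [CommRing R] [Nontrivial R] {q r : R[X]}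
    (hq : IsUnit q.leadingCoeff) (hr : IsUnit r.leadingCoeff) :
    IsUnit (q * r).leadingCoeff := by
  rw [leadingCoeff_mul' (hq.mul hr).ne_zero]
  exact hq.mul hr

/-- If mt = pd, then m̄t̄ = 0 in the domain ℤ_p[x] with m̄ ≠ 0, so t = ps. Cancelling p leaves a
divisibility modulo p. -/
theorem dvd_natCast_mul_iff {m d : (ZMod (p ^ 2))[X]} (hm : IsUnit m.leadingCoeff) :
    m ∣ (p : (ZMod (p ^ 2))[X]) * d ↔ reduceHom p m ∣ reduceHom p d := by
  constructor
  · rintro ⟨t, ht⟩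
    have h0 : reduceHom p m * reduceHom p t = 0 := by
      rw [← map_mul, ← ht]; simp
    have ht0 := (mul_eq_zero.1 h0).resolve_left (reduceHom_ne_zero hm)
    obtain ⟨s, rfl⟩ := (reduceHom_eq_zero_iff_dvd t).1 ht0
    have : (p : (ZMod (p ^ 2))[X]) * (d - m * s) = 0 := by linear_combination ht
    rw [natCast_mul_poly_eq_zero_iff, map_sub, map_mul, sub_eq_zero] at this
    exact ⟨_, this⟩
  · rintro ⟨t, ht⟩
    obtain ⟨s, rfl⟩ := reduceHom_surjective t
    have : (p : (ZMod (p ^ 2))[X]) * (d - m * s) = 0 := by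
      rw [natCast_mul_poly_eq_zero_iff, map_sub, map_mul, ht, sub_self]
    exact ⟨p * s, by linear_combination this⟩

theorem mul_dvd_mul_left_iff_of_isUnit_leadingCoeff {R : Type*} [CommRing R] {k m q : R[X]}
    (hk : IsUnit k.leadingCoeff) : k * m ∣ k * q ↔ m ∣ q := by
  refine ⟨?_, mul_dvd_mul_left k⟩
  rintro ⟨t, ht⟩
  refine ⟨t, sub_eq_zero.1 ((isUnit_leadingCoeff_mul_right_eq_zero_iff hk).1 ?_)⟩
  linear_combination ht

/-- If the kernel of an additive map on `ℤ_{p²}[x]` is the preimage of the ideal `(m)` of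
`ℤ_p[x]`, then its range has `p ^ deg m` elements. -/
theorem natCard_range_of_mem_ker_iff {G : Type*} [AddCommGroup G]
    (φ : (ZMod (p ^ 2))[X] →+ G) {m : (ZMod p)[X]} (hm : m ≠ 0)
    (hφ : ∀ d, φ d = 0 ↔ m ∣ reduceHom p d) :
    Nat.card φ.range = p ^ m.natDegree := by
  let ψ : (ZMod (p ^ 2))[X] →+ (ZMod p)[X] ⧸ Ideal.span {m} :=
    ((Ideal.Quotient.mk (Ideal.span {m})).comp (reduceHom p)).toAddMonoidHom
  have hψ : φ.ker = ψ.ker := by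
    ext d
    rw [AddMonoidHom.mem_ker, AddMonoidHom.mem_ker, hφ]
    simp [ψ, Ideal.Quotient.eq_zero_iff_mem, Ideal.mem_span_singleton]
  have hs : Function.Surjective ψ := by
    intro y
    obtain ⟨y, rfl⟩ := Ideal.Quotient.mk_surjective y
    obtain ⟨d, rfl⟩ := reduceHom_surjective y
    exact ⟨d, rfl⟩
  rw [← AddSubgroup.index_ker, hψ, AddSubgroup.index_ker, AddMonoidHom.range_eq_top.2 hs,
    AddSubgroup.card_top]
  have : Module.Finite (ZMod p) ((ZMod p)[X] ⧸ Ideal.span {m}) :=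
    (AdjoinRoot.powerBasis hm).finite
  rw [Module.natCard_eq_pow_finrank (K := ZMod p), Nat.card_zmod,
    finrank_quotient_span_eq_natDegree]

/-- The map `q ↦ c q̄` to `ℤ_p[x]/(x^n - 1)`. -/
def mulVecHom (n : ℕ) (c : (ZMod p)[X]) : (ZMod (p ^ 2))[X] →+ (Fin n → ZMod p) :=
  (toVecHom n).comp ((AddMonoidHom.mulLeft c).comp (reduceHom p).toAddMonoidHom)

/-- With x^n - 1 = cm, the kernel of q ↦ cq is (m), so counting gives dimension deg m. The degree
bound matters only for n = 0, where every c divides 0. -/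
theorem finrank_of_mem_iff {n : ℕ} {c : (ZMod p)[X]} (hc : c ∣ X ^ n - 1)
    (hdeg : c.natDegree ≤ n) (V : Submodule (ZMod p) (Fin n → ZMod p))
    (hV : ∀ u, u ∈ V ↔ ∃ q : (ZMod p)[X], u = toVec n (c * q)) :
    (Module.finrank (ZMod p) V : ℤ) = (n : ℤ) - c.natDegree := by
  rcases Nat.eq_zero_or_pos n with rfl | hn
  · have : c.natDegree = 0 := by omega
    rw [this, Module.finrank_zero_of_subsingleton]
    simp
  obtain ⟨m, hm⟩ := hc
  have hmon : (X ^ n - 1 : (ZMod p)[X]).Monic := monic_X_pow_sub_C 1 hn.ne'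
  have hcm : c * m ≠ 0 := hm ▸ hmon.ne_zero
  have hc0 := left_ne_zero_of_mul hcm
  have hm0 := right_ne_zero_of_mul hcm
  have hd : n = c.natDegree + m.natDegree := by
    rw [← natDegree_mul hc0 hm0, ← hm]
    exact (natDegree_X_pow_sub_C (r := 1)).symm
  have hcard : Nat.card V = p ^ m.natDegree := by
    rw [← natCard_range_of_mem_ker_iff (mulVecHom n c) hm0]
    · refine Nat.card_congr (Equiv.subtypeEquivRight fun u => ?_)
      rw [hV, AddMonoidHom.mem_range]
      constructor
      · rintro ⟨q, rfl⟩
        obtain ⟨d, rfl⟩ := reduceHom_surjective q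
        exact ⟨d, rfl⟩
      · rintro ⟨d, rfl⟩
        exact ⟨_, rfl⟩
    · intro d
      refine (toVec_eq_zero_iff (q := c * reduceHom p d) hn).trans ?_
      rw [hm, mul_dvd_mul_iff_left hc0]
  rw [Module.natCard_eq_pow_finrank (K := ZMod p), Nat.card_zmod] at hcard
  have := Nat.pow_right_injective (Fact.out : p.Prime).two_le hcard
  omega

end Reduction

/-! ### Finite abelian groups of exponent dividing p² -/

section GroupType

variable {p : ℕ} [Fact p.Prime]

theorem natCard_torsion_zmod_sq :
    Nat.card {x : ZMod (p ^ 2) // p • x = 0} = p := by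
  let φ := (ZMod.castHom (dvd_pow_self p two_ne_zero) (ZMod p)).toAddMonoidHom
  have h := φ.ker.card_mul_index
  rw [AddSubgroup.index_ker, AddMonoidHom.range_eq_top.2 (ZMod.ringHom_surjective _),
    AddSubgroup.card_top, Nat.card_zmod, Nat.card_zmod] at h
  refine Eq.trans ?_ (Nat.eq_of_mul_eq_mul_right (Fact.out : p.Prime).pos (h.trans (sq p)))
  refine Nat.card_congr (Equiv.subtypeEquivRight fun x => ?_)
  rw [nsmul_eq_mul, natCast_mul_eq_zero_iff]
  rfl

theorem natCard_torsion_of_addEquiv {G : Type*} [AddCommGroup G] {γ δ : ℕ}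
    (e : G ≃+ (Fin γ → ZMod p) × (Fin δ → ZMod (p ^ 2))) :
    Nat.card {x : G // p • x = 0} = p ^ (γ + δ) := by
  have e1 : {x : G // p • x = 0} ≃
      {y : (Fin γ → ZMod p) × (Fin δ → ZMod (p ^ 2)) // p • y = 0} :=
    e.toEquiv.subtypeEquiv fun x => by
      rw [← e.map_eq_zero_iff, map_nsmul]; rfl
  have e2 : {y : (Fin γ → ZMod p) × (Fin δ → ZMod (p ^ 2)) // p • y = 0} ≃
      (Fin γ → ZMod p) × (Fin δ → {x : ZMod (p ^ 2) // p • x = 0}) :=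
    { toFun := fun y => (y.1.1, fun i => ⟨y.1.2 i, congrFun (congrArg Prod.snd y.2) i⟩)
      invFun := fun z => ⟨(z.1, fun i => (z.2 i).1), by
        ext i
        · simp
        · exact (z.2 i).2⟩
      left_inv := fun y => rfl
      right_inv := fun z => rfl }
  rw [Nat.card_congr (e1.trans e2), Nat.card_prod, Nat.card_fun, Nat.card_fun,
    natCard_torsion_zmod_sq]
  simp [pow_add]

theorem natCard_of_addEquiv {G : Type*} [AddCommGroup G] {γ δ : ℕ}
    (e : G ≃+ (Fin γ → ZMod p) × (Fin δ → ZMod (p ^ 2))) :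
    Nat.card G = p ^ (γ + 2 * δ) := by
  rw [Nat.card_congr e.toEquiv, Nat.card_prod, Nat.card_fun, Nat.card_fun]
  simp [pow_add, pow_mul]

theorem exists_addEquiv_of_sq_nsmul_eq_zero (G : Type*) [AddCommGroup G] [Finite G]
    (hG : ∀ x : G, p ^ 2 • x = 0) :
    ∃ γ δ : ℕ, Nonempty (G ≃+ (Fin γ → ZMod p) × (Fin δ → ZMod (p ^ 2))) := by
  classical
  obtain ⟨ι, _, n, hn, ⟨e⟩⟩ := AddCommGroup.equiv_directSum_zmod_of_finite' G
  replace e := e.trans (DirectSum.addEquivProd _)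
  have hdvd : ∀ i, n i ∣ p ^ 2 := fun i => by
    have h := hG (e.symm (Pi.single i 1))
    rw [← map_nsmul, EmbeddingLike.map_eq_zero_iff] at h
    have := congrFun h i
    simpa [← ZMod.natCast_eq_zero_iff] using this
  have hcase : ∀ i, n i ≠ p → n i = p ^ 2 := fun i hi => by
    obtain ⟨k, hk, hk'⟩ := (Nat.dvd_prime_pow (Fact.out : p.Prime)).1 (hdvd i)
    have := hn i
    interval_cases k
    · simp_all
    · simp_all
    · exact hk'
  let s := fun i => n i = p
  let e1 : (∀ i, ZMod (n i)) ≃+ (∀ i : {i // s i}, ZMod (n i)) × (∀ i : {i // ¬ s i}, ZMod (n i)) :=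
    { Equiv.piEquivPiSubtypeProd s (fun i => ZMod (n i)) with map_add' := fun _ _ => rfl }
  let e2 : (∀ i : {i // s i}, ZMod (n i)) ≃+ ({i // s i} → ZMod p) :=
    AddEquiv.piCongrRight fun i => (ZMod.ringEquivCongr i.2).toAddEquiv
  let e3 : (∀ i : {i // ¬ s i}, ZMod (n i)) ≃+ ({i // ¬ s i} → ZMod (p ^ 2)) :=
    AddEquiv.piCongrRight fun i => (ZMod.ringEquivCongr (hcase i i.2)).toAddEquiv
  let e4 : ({i // s i} → ZMod p) ≃+ (Fin (Fintype.card {i // s i}) → ZMod p) :=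
    (LinearEquiv.funCongrLeft ℤ (ZMod p) (Fintype.equivFin {i // s i}).symm).toAddEquiv
  let e5 : ({i // ¬ s i} → ZMod (p ^ 2)) ≃+ (Fin (Fintype.card {i // ¬ s i}) → ZMod (p ^ 2)) :=
    (LinearEquiv.funCongrLeft ℤ (ZMod (p ^ 2)) (Fintype.equivFin {i // ¬ s i}).symm).toAddEquiv
  exact ⟨_, _, ⟨e.trans (e1.trans (AddEquiv.prodCongr (e2.trans e4) (e3.trans e5)))⟩⟩

/-- The type of a finite group of exponent dividing `p²` is determined by the orders of its
`p`-torsion and of its image under multiplication by `p`. -/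
theorem nonempty_addEquiv_iff {G : Type*} [AddCommGroup G] [Finite G]
    (hG : ∀ x : G, p ^ 2 • x = 0) {s t : ℕ}
    (hs : Nat.card {x : G // p • x = 0} = p ^ s)
    (ht : Nat.card (nsmulAddMonoidHom p : G →+ G).range = p ^ t) (γ δ : ℕ) :
    Nonempty (G ≃+ (Fin γ → ZMod p) × (Fin δ → ZMod (p ^ 2))) ↔ γ + δ = s ∧ δ = t := by
  have key : ∀ γ δ : ℕ, Nonempty (G ≃+ (Fin γ → ZMod p) × (Fin δ → ZMod (p ^ 2))) →
      γ + δ = s ∧ δ = t := by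
    rintro γ δ ⟨e⟩
    have inj := Nat.pow_right_injective (Fact.out : p.Prime).two_le
    have h1 : γ + δ = s := inj ((natCard_torsion_of_addEquiv e).symm.trans hs)
    have hcard := (nsmulAddMonoidHom p : G →+ G).ker.card_mul_index
    rw [AddSubgroup.index_ker, ht, natCard_of_addEquiv e] at hcard
    have hs' : Nat.card (nsmulAddMonoidHom p : G →+ G).ker = p ^ s := hs
    rw [hs', ← pow_add] at hcard
    have h2 : s + t = γ + 2 * δ := inj hcard
    omega
  refine ⟨key γ δ, fun ⟨h1, h2⟩ => ?_⟩
  -- Some type exists by the structure theorem, and `key` forces it to be the prescribed one.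
  obtain ⟨γ', δ', h⟩ := exists_addEquiv_of_sq_nsmul_eq_zero G hG
  obtain ⟨h3, h4⟩ := key γ' δ' h
  obtain rfl : γ = γ' := by omega
  obtain rfl : δ = δ' := by omega
  exact h

end GroupType

/-! ### Words of the code and their torsion -/

section Code

variable {p : ℕ} {α β : ℕ}

theorem star_toWord (d : (ZMod (p ^ 2))[X]) (q : (ZMod p)[X]) (r : (ZMod (p ^ 2))[X]) :
    star d (toWord α β q r) = toWord α β (reduceHom p d * q) (d * r) :=
  Prod.ext (toVec_mul_ofVec_toVec _ _) (toVec_mul_ofVec_toVec _ _)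

/-- `toWord` as an additive homomorphism. -/
def toWordHom (p α β : ℕ) : (ZMod p)[X] × (ZMod (p ^ 2))[X] →+ Word p α β :=
  (toVecHom α).prodMap (toVecHom β)

theorem toWord_add (q q' : (ZMod p)[X]) (r r' : (ZMod (p ^ 2))[X]) :
    toWord α β q r + toWord α β q' r' = toWord α β (q + q') (r + r') :=
  ((toWordHom p α β).map_add (q, r) (q', r')).symm

theorem toWord_neg (q : (ZMod p)[X]) (r : (ZMod (p ^ 2))[X]) :
    -toWord α β q r = toWord α β (-q) (-r) :=
  ((toWordHom p α β).map_neg (q, r)).symm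

theorem nsmul_toWord (n : ℕ) (q : (ZMod p)[X]) (r : (ZMod (p ^ 2))[X]) :
    n • toWord α β q r = toWord α β ((n : (ZMod p)[X]) * q) ((n : (ZMod (p ^ 2))[X]) * r) := by
  have := (toWordHom p α β).map_nsmul n (q, r)
  rw [Prod.smul_mk, nsmul_eq_mul, nsmul_eq_mul] at this
  exact this.symm

/-- Reduction is onto ℤ_p[x] and the first generator vanishes in the second block, so its multiplier
q can be taken over ℤ_p, independently of d. -/
theorem mem_polySpan_pair {a b : (ZMod p)[X]} {F : (ZMod (p ^ 2))[X]} {w : Word p α β} :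
    w ∈ polySpan {toWord α β a 0, toWord α β b F} ↔
      ∃ q : (ZMod p)[X], ∃ d : (ZMod (p ^ 2))[X],
        w = toWord α β (q * a + reduceHom p d * b) (d * F) := by
  constructor
  · intro hw
    induction hw using AddSubgroup.closure_induction with
    | mem w hw =>
      obtain ⟨d, s, rfl | rfl, rfl⟩ := hw
      · exact ⟨reduceHom p d, 0, by rw [star_toWord]; simp⟩
      · exact ⟨0, d, by rw [star_toWord]; simp⟩
    | zero => exact ⟨0, 0, by
      simp only [zero_mul, map_zero, add_zero]
      exact ((toWordHom p α β).map_zero).symm⟩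
    | add w w' _ _ h h' =>
      obtain ⟨q, d, rfl⟩ := h
      obtain ⟨q', d', rfl⟩ := h'
      refine ⟨q + q', d + d', ?_⟩
      rw [toWord_add, map_add]
      congr 1 <;> ring
    | neg w _ h =>
      obtain ⟨q, d, rfl⟩ := h
      refine ⟨-q, -d, ?_⟩
      rw [toWord_neg, map_neg]
      congr 1 <;> ring
  · rintro ⟨q, d, rfl⟩
    obtain ⟨l, rfl⟩ := reduceHom_surjective q
    have h1 : star l (toWord α β a 0) ∈ polySpan {toWord α β a 0, toWord α β b F} :=
      AddSubgroup.subset_closure ⟨l, _, by simp, rfl⟩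
    have h2 : star d (toWord α β b F) ∈ polySpan {toWord α β a 0, toWord α β b F} :=
      AddSubgroup.subset_closure ⟨d, _, by simp, rfl⟩
    have := add_mem h1 h2
    rwa [star_toWord, star_toWord, toWord_add, mul_zero, zero_add] at this

/-- The map `d ↦ k d` to `ℤ_{p²}[x]/(x^n - 1)`. -/
def mulVecHomSq (p n : ℕ) (k : (ZMod (p ^ 2))[X]) :
    (ZMod (p ^ 2))[X] →+ (Fin n → ZMod (p ^ 2)) :=
  (toVecHom n).comp (AddMonoidHom.mulLeft k)

variable [Fact p.Prime]

theorem natCard_range_mulVecHomSq (hβ : 0 < β) {k m : (ZMod (p ^ 2))[X]}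
    (hk : IsUnit k.leadingCoeff) (hm : IsUnit m.leadingCoeff) (hkm : k * m = X ^ β - 1) :
    Nat.card (mulVecHomSq p β ((p : (ZMod (p ^ 2))[X]) * k)).range = p ^ m.natDegree := by
  rw [natCard_range_of_mem_ker_iff _ (reduceHom_ne_zero hm), natDegree_reduceHom hm]
  intro d
  refine (toVec_eq_zero_iff (q := (p : (ZMod (p ^ 2))[X]) * k * d) hβ).trans ?_
  rw [← hkm, show (p : (ZMod (p ^ 2))[X]) * k * d = k * ((p : (ZMod (p ^ 2))[X]) * d) by ring,
    mul_dvd_mul_left_iff_of_isUnit_leadingCoeff hk, dvd_natCast_mul_iff hm]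

variable {a b : (ZMod p)[X]} {f h g : (ZMod (p ^ 2))[X]}

/-- Since p ∤ β, x^β - 1 is separable modulo p, so its factors share no root. -/
theorem isCoprime_reduceHom (hβ : Nat.gcd β p = 1) (hfhg : f * h * g = X ^ β - 1) :
    IsCoprime (reduceHom p h) (reduceHom p g) := by
  have hβ0 : (β : ZMod p) ≠ 0 := by
    rw [Ne, ZMod.natCast_eq_zero_iff]
    exact fun hd => (Fact.out : p.Prime).one_lt.ne' (by rw [← hβ, Nat.gcd_eq_right hd])
  have hs : (X ^ β - 1 : (ZMod p)[X]).Separable := X_pow_sub_one_separable_iff.2 hβ0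
  have he : (X ^ β - 1 : (ZMod p)[X]) =
      reduceHom p f * (reduceHom p h * reduceHom p g) := by
    rw [← map_mul, ← map_mul, ← mul_assoc, hfhg]
    simp [reduceHom]
  rw [he] at hs
  exact hs.of_mul_right.isCoprime

/-- The second generator is annihilated by `d` modulo `p`-torsion exactly when `ḡ ∣ d̄`. -/
theorem toVec_natCast_mul_eq_zero_iff (hβ : 0 < β)
    (hf : IsUnit f.leadingCoeff) (hh : IsUnit h.leadingCoeff) (hg : IsUnit g.leadingCoeff)
    (hfhg : f * h * g = X ^ β - 1) (d : (ZMod (p ^ 2))[X]) :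
    toVec β ((p : (ZMod (p ^ 2))[X]) * (d * (f * h + (p : (ZMod (p ^ 2))[X]) * f))) = 0 ↔
      reduceHom p g ∣ reduceHom p d := by
  rw [toVec_eq_zero_iff hβ, ← hfhg, show
    (p : (ZMod (p ^ 2))[X]) * (d * (f * h + p * f)) =
    f * h * ((p : (ZMod (p ^ 2))[X]) * d) by linear_combination d * f * natCast_sq_eq_zero (p := p),
    mul_dvd_mul_left_iff_of_isUnit_leadingCoeff (isUnit_leadingCoeff_mul hf hh),
    dvd_natCast_mul_iff hg]

/-- Multiplying by p gives d = ge + pe'. Cancelling f then leaves hg ∣ p(ge + e'h), so h̄ ∣ ḡē, and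
coprimality gives h̄ ∣ ē. -/
theorem reduceHom_dvd_of_toVec_eq_zero (hβ : 0 < β)
    (hf : IsUnit f.leadingCoeff) (hh : IsUnit h.leadingCoeff) (hg : IsUnit g.leadingCoeff)
    (hcop : IsCoprime (reduceHom p h) (reduceHom p g))
    (hfhg : f * h * g = X ^ β - 1) {d : (ZMod (p ^ 2))[X]}
    (hd : toVec β (d * (f * h + (p : (ZMod (p ^ 2))[X]) * f)) = 0) :
    reduceHom p (h * g) ∣ reduceHom p d := by
  rw [toVec_eq_zero_iff hβ] at hd
  have h1 : reduceHom p g ∣ reduceHom p d := by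
    rw [← toVec_natCast_mul_eq_zero_iff hβ hf hh hg hfhg, toVec_eq_zero_iff hβ]
    exact hd.mul_left _
  obtain ⟨e, he⟩ := h1
  obtain ⟨e, rfl⟩ := reduceHom_surjective e
  obtain ⟨e', he'⟩ := (reduceHom_eq_zero_iff_dvd (d - g * e)).1 (by simp [he])
  rw [← hfhg, mul_assoc, show d * (f * h + p * f) = f * (d * h + p * d) by ring,
    mul_dvd_mul_left_iff_of_isUnit_leadingCoeff hf] at hd
  have h2 : h * g ∣ p * (g * e + e' * h) := by
    have : (p : (ZMod (p ^ 2))[X]) * (g * e + e' * h) =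
      (d * h + p * d) - h * g * e := by
      linear_combination (-h - p) * he' - e' * natCast_sq_eq_zero (p := p)
    rw [this]
    exact dvd_sub hd (dvd_mul_right _ _)
  rw [dvd_natCast_mul_iff (isUnit_leadingCoeff_mul hh hg)] at h2
  have h3 : reduceHom p h ∣ reduceHom p e := by
    have : reduceHom p h ∣ reduceHom p (g * e + e' * h) :=
      (Dvd.intro _ (map_mul _ _ _).symm).trans h2
    rw [map_add, map_mul, map_mul] at this
    exact hcop.dvd_of_dvd_mul_left ((dvd_add_left (dvd_mul_left _ _)).1 this)
  rw [he, map_mul, mul_comm]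
  exact mul_dvd_mul_left _ h3

theorem mem_kernelX_iff (hβ : 0 < β)
    (hf : IsUnit f.leadingCoeff) (hh : IsUnit h.leadingCoeff) (hg : IsUnit g.leadingCoeff)
    (hcop : IsCoprime (reduceHom p h) (reduceHom p g)) (hfhg : f * h * g = X ^ β - 1)
    (hab : a ∣ reduceHom p (h * g) * b) (u : Fin α → ZMod p) :
    u ∈ kernelX (polySpan {toWord α β a 0, toWord α β b (f * h + p * f)}) ↔
      ∃ q, u = toVec α (a * q) := by
  change (u, (0 : Fin β → ZMod (p ^ 2))) ∈ polySpan _ ↔ _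
  rw [mem_polySpan_pair]
  constructor
  · rintro ⟨q, d, hw⟩
    have h1 := congrArg Prod.fst hw
    have h2 := congrArg Prod.snd hw
    have hd := reduceHom_dvd_of_toVec_eq_zero hβ hf hh hg hcop hfhg h2.symm
    obtain ⟨s, hs⟩ : a ∣ reduceHom p d * b := hab.trans (mul_dvd_mul_right hd b)
    refine ⟨q + s, h1.trans ?_⟩
    change toVec α (q * a + reduceHom p d * b) = _
    rw [hs]
    congr 1
    ring
  · rintro ⟨q, rfl⟩
    refine ⟨q, 0, Prod.ext ?_ ?_⟩
    · simp [toWord, mul_comm]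
    · exact ((toVecHom β).map_zero.symm).trans (congrArg (toVec β) (zero_mul _).symm)

theorem mem_punctureX_torsionSubcode_iff (hβ : 0 < β)
    (hf : IsUnit f.leadingCoeff) (hh : IsUnit h.leadingCoeff) (hg : IsUnit g.leadingCoeff)
    (hfhg : f * h * g = X ^ β - 1) (u : Fin α → ZMod p) :
    u ∈ punctureX (torsionSubcode
        (polySpan {toWord α β a 0, toWord α β b (f * h + p * f)})) ↔
      ∃ q, u = toVec α (EuclideanDomain.gcd a (b * reduceHom p g) * q) := by
  change (∃ w : Word p α β, (w ∈ polySpan _ ∧ p • w = (0 : Word p α β)) ∧ w.1 = u) ↔ _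
  simp only [mem_polySpan_pair]
  constructor
  · rintro ⟨_, ⟨⟨q, d, rfl⟩, hw⟩, rfl⟩
    rw [nsmul_toWord] at hw
    obtain ⟨e, he⟩ := (toVec_natCast_mul_eq_zero_iff hβ hf hh hg hfhg d).1
      (congrArg Prod.snd hw)
    obtain ⟨s, hs⟩ := EuclideanDomain.gcd_dvd_left a (b * reduceHom p g)
    obtain ⟨t, ht⟩ := EuclideanDomain.gcd_dvd_right a (b * reduceHom p g)
    refine ⟨s * q + t * e, congrArg (toVec α) ?_⟩
    linear_combination q * hs + e * ht + b * he
  · rintro ⟨q, rfl⟩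
    -- Bézout: d = gy makes the word p-torsion while its first block becomes gcd(a, bḡ)·q.
    obtain ⟨y, hy⟩ := reduceHom_surjective (EuclideanDomain.gcdB a (b * reduceHom p g) * q)
    refine ⟨_, ⟨⟨EuclideanDomain.gcdA a (b * reduceHom p g) * q, g * y, rfl⟩, ?_⟩, ?_⟩
    · rw [nsmul_toWord]
      refine Prod.ext ?_ ?_
      · refine (congrArg (toVec α) ?_).trans (toVecHom α).map_zero
        simp
      · exact (toVec_natCast_mul_eq_zero_iff hβ hf hh hg hfhg _).2 (by simp)
    · refine congrArg (toVec α) ?_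
      rw [map_mul, hy]
      linear_combination (-q) * EuclideanDomain.gcd_eq_gcd_ab a (b * reduceHom p g)

/-- The words of `C_p` project onto the multiples of `p f` in the second block. -/
theorem natCard_torsionSubcode (hβ : 0 < β)
    (hf : IsUnit f.leadingCoeff) (hh : IsUnit h.leadingCoeff) (hg : IsUnit g.leadingCoeff)
    (hcop : IsCoprime (reduceHom p h) (reduceHom p g)) (hfhg : f * h * g = X ^ β - 1) :
    Nat.card (torsionSubcode (polySpan {toWord α β a 0, toWord α β b (f * h + p * f)})) =
      Nat.card (kernelX (polySpan {toWord α β a 0, toWord α β b (f * h + p * f)})) *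
        p ^ (h.natDegree + g.natDegree) := by
  set D := polySpan {toWord α β a 0, toWord α β b (f * h + p * f)} with hD
  let π : torsionSubcode D →+ (Fin β → ZMod (p ^ 2)) :=
    (AddMonoidHom.snd _ _).comp (torsionSubcode D).subtype
  have hker : Nat.card π.ker = Nat.card (kernelX D) := by
    refine Nat.card_congr
      { toFun := fun w => ⟨w.1.1.1, ?_⟩
        invFun := fun u => ⟨⟨(u.1, 0), u.2, ?_⟩, rfl⟩
        left_inv := ?_
        right_inv := fun u => rfl }
    · have h1 : w.1.1.2 = 0 := w.2
      have h2 : w.1.1 ∈ D := w.1.2.1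
      change (w.1.1.1, (0 : Fin β → ZMod (p ^ 2))) ∈ D
      rwa [← h1]
    · change p • ((u.1, 0) : Word p α β) = 0
      ext <;> simp
    · rintro ⟨⟨w, hw⟩, hw'⟩
      have h1 : w.2 = 0 := hw'
      exact Subtype.ext (Subtype.ext (Prod.ext rfl h1.symm))
  have hrange : π.range = (mulVecHomSq p β ((p : (ZMod (p ^ 2))[X]) * f)).range := by
    ext v
    constructor
    · rintro ⟨⟨w, hw1, hw2⟩, rfl⟩
      obtain ⟨q, d, rfl⟩ := mem_polySpan_pair.1 hw1
      have hw2' : p • toWord α β (q * a + reduceHom p d * b) (d * (f * h + p * f)) = 0 := hw2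
      rw [nsmul_toWord] at hw2'
      obtain ⟨e, he⟩ := (toVec_natCast_mul_eq_zero_iff hβ hf hh hg hfhg d).1
        (congrArg Prod.snd hw2')
      obtain ⟨e, rfl⟩ := reduceHom_surjective e
      obtain ⟨e', he'⟩ := (reduceHom_eq_zero_iff_dvd (d - g * e)).1 (by simp [he])
      -- Expanding with d = ge + pe' and p² = 0: d(fh + pf) = fhg·e + pf(ge + he').
      refine ⟨g * e + h * e', ?_⟩
      refine toVec_eq_of_dvd_sub (q := (p : (ZMod (p ^ 2))[X]) * f * (g * e + h * e'))
        (r := d * (f * h + p * f)) ⟨-e, ?_⟩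
      rw [← hfhg]
      linear_combination (-(f * h + p * f)) * he' -
        e' * f * natCast_sq_eq_zero (p := p)
    · rintro ⟨r, rfl⟩
      obtain ⟨x, y, hxy⟩ := hcop
      obtain ⟨x, rfl⟩ := reduceHom_surjective x
      obtain ⟨y, rfl⟩ := reduceHom_surjective y
      have hr : (p : (ZMod (p ^ 2))[X]) * (x * h + y * g - 1) = 0 := by
        rw [natCast_mul_poly_eq_zero_iff]
        simp [hxy]
      -- With this d, d(fh + pf) = fhg·yr + pf·r(xh + yg), and xh + yg ≡ 1 modulo p. It is torsion
      -- because ḡ ∣ d̄.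
      refine ⟨⟨_, mem_polySpan_pair.2 ⟨0, g * (y * r) + p * (x * r), rfl⟩, ?_⟩, ?_⟩
      · change p • toWord α β _ _ = 0
        rw [nsmul_toWord]
        refine Prod.ext ?_ ?_
        · refine (congrArg (toVec α) ?_).trans (toVecHom α).map_zero
          simp
        · exact (toVec_natCast_mul_eq_zero_iff hβ hf hh hg hfhg _).2 (by simp)
      · refine toVec_eq_of_dvd_sub
          (q := (g * (y * r) + (p : (ZMod (p ^ 2))[X]) * (x * r)) * (f * h + (p : (ZMod (p ^ 2))[X]) * f))
          (r := (p : (ZMod (p ^ 2))[X]) * f * r) ⟨y * r, ?_⟩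
        rw [← hfhg]
        linear_combination f * r * hr + x * r * f * natCast_sq_eq_zero (p := p)
  have hcard := π.ker.card_mul_index
  have hhg := isUnit_leadingCoeff_mul hh hg
  rw [AddSubgroup.index_ker, hker, hrange,
    natCard_range_mulVecHomSq hβ hf hhg (by rw [← hfhg, mul_assoc]),
    natDegree_mul' (hh.mul hg).ne_zero] at hcard
  exact hcard.symm

/-- Multiplication by p kills the first block and turns the second into p·fh·d, so p𝒞 is counted by
multiples of p·fh. -/
theorem natCard_range_nsmul (hβ : 0 < β)
    (hf : IsUnit f.leadingCoeff) (hh : IsUnit h.leadingCoeff) (hg : IsUnit g.leadingCoeff)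
    (hfhg : f * h * g = X ^ β - 1) :
    Nat.card (nsmulAddMonoidHom p :
      polySpan {toWord α β a 0, toWord α β b (f * h + p * f)} →+ _).range =
        p ^ g.natDegree := by
  rw [← natCard_range_mulVecHomSq hβ (isUnit_leadingCoeff_mul hf hh) hg hfhg]
  have key : ∀ (q : (ZMod p)[X]) (d : (ZMod (p ^ 2))[X]),
      p • toWord α β (q * a + reduceHom p d * b) (d * (f * h + p * f)) =
        (0, mulVecHomSq p β ((p : (ZMod (p ^ 2))[X]) * (f * h)) d) := fun q d => by
    rw [nsmul_toWord]
    refine Prod.ext ?_ ?_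
    · refine (congrArg (toVec α) ?_).trans (toVecHom α).map_zero
      simp
    · refine congrArg (toVec β) ?_
      change (p : (ZMod (p ^ 2))[X]) * (d * (f * h + p * f)) =
        p * (f * h) * d
      linear_combination d * f * natCast_sq_eq_zero (p := p)
  refine Nat.card_congr (Equiv.ofBijective (fun w => ⟨w.1.1.2, ?_⟩) ⟨?_, ?_⟩)
  · obtain ⟨_, ⟨⟨w, hw⟩, rfl⟩⟩ := w
    obtain ⟨q, d, rfl⟩ := mem_polySpan_pair.1 hw
    exact ⟨d, (congrArg Prod.snd (key q d)).symm⟩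
  · rintro ⟨_, ⟨⟨w, hw⟩, rfl⟩⟩ ⟨_, ⟨⟨w', hw'⟩, rfl⟩⟩ heq
    have h2 : (p • w).2 = (p • w').2 := congrArg Subtype.val heq
    refine Subtype.ext (Subtype.ext (Prod.ext ?_ h2))
    change p • w.1 = p • w'.1
    ext
    simp
  · rintro ⟨_, ⟨d, rfl⟩⟩
    refine ⟨⟨_, ⟨⟨_, mem_polySpan_pair.2 ⟨0, d, rfl⟩⟩, rfl⟩⟩, Subtype.ext ?_⟩
    exact congrArg Prod.snd (key 0 d)

end Code

end ZpZp2
end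
theorem mainTheorem3 (p : ℕ) [Fact p.Prime] (hp : Odd p) (α β : ℕ) (hβ : Nat.gcd β p = 1)
    (a b : (ZMod p)[X]) (f h g : (ZMod (p ^ 2))[X])
    (hf : IsUnit f.leadingCoeff) (hh : IsUnit h.leadingCoeff) (hg : IsUnit g.leadingCoeff)
    (hfhg : f * h * g = X ^ β - 1)
    (ha : a ∣ X ^ α - 1) (ha_deg : a.natDegree ≤ α)
    (hab : a ∣ ZpZp2.reduce (h * g) * b)
    (C : AddSubgroup (ZpZp2.Word p α β)) (hC : ZpZp2.IsCyclicCode C)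
    (hgen : C = ZpZp2.polySpan
      {ZpZp2.toWord α β a 0,
        ZpZp2.toWord α β b (f * h + (p : (ZMod (p ^ 2))[X]) * f)}) :
    (∀ γ δ : ℕ, ZpZp2.HasGroupType C γ δ ↔
      (γ : ℤ) = (α : ℤ) - a.natDegree + h.natDegree ∧ δ = g.natDegree) ∧
    (ZpZp2.kappa C : ℤ) =
      (α : ℤ) - (EuclideanDomain.gcd a (b * ZpZp2.reduce g)).natDegree ∧
    (ZpZp2.kappa₁ C : ℤ) = (α : ℤ) - a.natDegree ∧
    ZpZp2.kappa₂ C =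
      (a.natDegree : ℤ) - (EuclideanDomain.gcd a (b * ZpZp2.reduce g)).natDegree := by
  have hβ0 : 0 < β := by
    refine Nat.pos_of_ne_zero fun h0 => (Fact.out : p.Prime).one_lt.ne' ?_
    rw [← hβ, h0, Nat.gcd_zero_left]
  have hcop := ZpZp2.isCoprime_reduceHom hβ hfhg
  have hk1 : (ZpZp2.kappa₁ C : ℤ) = (α : ℤ) - a.natDegree :=
    ZpZp2.finrank_of_mem_iff ha ha_deg _ fun u => by
      rw [hgen]
      exact ZpZp2.mem_kernelX_iff hβ0 hf hh hg hcop hfhg hab u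
  have hdvd := EuclideanDomain.gcd_dvd_left a (b * ZpZp2.reduce g)
  have hdeg : (EuclideanDomain.gcd a (b * ZpZp2.reduce g)).natDegree ≤ α := by
    -- The zero polynomial is possible when α = 0; the gcd is then bḡ up to a unit, and 0 ∣ h̄ḡb
    -- forces b = 0, so its degree is 0.
    by_cases ha0 : a = 0
    · have hhg := ZpZp2.reduceHom_ne_zero (p := p) (ZpZp2.isUnit_leadingCoeff_mul hh hg)
      have hb : b = 0 := by
        rw [ha0, zero_dvd_iff] at hab
        exact (mul_eq_zero.1 hab).resolve_left hhg
      simp [ha0, hb]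
    · exact (natDegree_le_of_dvd hdvd ha0).trans ha_deg
  have hk : (ZpZp2.kappa C : ℤ) =
      (α : ℤ) - (EuclideanDomain.gcd a (b * ZpZp2.reduce g)).natDegree :=
    ZpZp2.finrank_of_mem_iff (hdvd.trans ha) hdeg _ fun u => by
      rw [hgen]
      exact ZpZp2.mem_punctureX_torsionSubcode_iff hβ0 hf hh hg hfhg u
  refine ⟨fun γ δ => ?_, hk, hk1, by rw [ZpZp2.kappa₂, hk, hk1]; ring⟩
  have hexp : ∀ x : C, p ^ 2 • x = 0 := fun x => Subtype.ext <| by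
    change p ^ 2 • (x : ZpZp2.Word p α β) = 0
    ext
    · simp
    · change p ^ 2 • _ = (0 : ZMod (p ^ 2))
      rw [nsmul_eq_mul, CharP.cast_eq_zero, zero_mul]
  have htor : Nat.card {x : C // p • x = 0} =
      p ^ (ZpZp2.kappa₁ C + (h.natDegree + g.natDegree)) := by
    have hcard := ZpZp2.natCard_torsionSubcode (α := α) (a := a) (b := b) hβ0 hf hh hg hcop hfhg
    rw [← hgen, Module.natCard_eq_pow_finrank (K := ZMod p) (V := ZpZp2.kernelX C),
      Nat.card_zmod, ← pow_add] at hcard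
    refine Eq.trans (Nat.card_congr ?_) hcard
    exact
      { toFun := fun x => ⟨x.1.1, x.1.2, congrArg Subtype.val x.2⟩
        invFun := fun x => ⟨⟨x.1, x.2.1⟩, Subtype.ext x.2.2⟩
        left_inv := fun x => rfl
        right_inv := fun x => rfl }
  have hrange : Nat.card (nsmulAddMonoidHom p : C →+ C).range = p ^ g.natDegree := by
    rw [hgen]
    exact ZpZp2.natCard_range_nsmul hβ0 hf hh hg hfhg
  refine (ZpZp2.nonempty_addEquiv_iff hexp htor hrange γ δ).trans ?_
  omega
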